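/- **Conventions.** Let $\mathbf a$ be an algebra with universe $A$ and $\alpha,\beta\in\mathrm{Con}(\mathbf a)$. Let $R(\alpha,\beta)$ be the set of matrices $\begin{bmatrix}a&c\\b&d\end{bmatrix}\in A^{2\times2}$ with $(a,b),(c,d)\in\alpha$ and $(a,c),(b,d)\in\beta$; we also write $(a,b,c,d)\in R(\alpha,\beta)$. Let $M(\alpha,\beta)$ be the subalgebra of $\mathbf a^{2\times2}$ generated by all $\begin{bmatrix}c&c\\d&d\end{bmatrix}$ with $(c,d)\in\alpha$ and all $\begin{bmatrix}a&c\\a&c\end{bmatrix}$ with $(a,c)\in\beta$. Let $\Delta^*(\alpha,\beta)$ be the smallest subset of $R(\alpha,\beta)$ that contains $M(\alpha,\beta)$ and is closed under horizontal gluing (if $\begin{bmatrix}a&a'\\b&b'\end{bmatrix}$ and $\begin{bmatrix}a'&a''\\b'&b''\end{bmatrix}$ are in the set, so is $\begin{bmatrix}a&a''\\b&b''\end{bmatrix}$) and vertical gluing (if $\begin{bmatrix}a&a'\\b&b'\end{bmatrix}$ and $\begin{bmatrix}b&b'\\c&c'\end{bmatrix}$ are in the set, so is $\begin{bmatrix}a&a'\\c&c'\end{bmatrix}$).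 The commutator $[\alpha,\beta]$ is the least congruence $\delta$ of $\mathbf a$ such that $(b,d)\in\delta$ implies $(a,c)\in\delta$ for all $\begin{bmatrix}a&c\\b&d\end{bmatrix}\in M(\alpha,\beta)$; $[\alpha,\beta]=0$ means that it is the equality relation. A *difference term* for a variety $\mathcal V$ is a ternary term $p$ such that $p(x,x,y)\approx y$ holds in $\mathcal V$ and $(p(a,b,b),a)\in[\theta,\theta]$ whenever $(a,b)\in\theta\in\mathrm{Con}(\mathbf a)$, $\mathbf a\in\mathcal V$. A *Kiss term* for $\mathcal V$ is a 4-ary term $q$ such that $q(x,x,y,y)\approx y$ and $q(x,y,x,y)\approx x$ hold in $\mathcal V$ and $(q(a,b,c,d),q(a,b,c',d))\in[\alpha,\beta]$ whenever $\alpha,\beta\in\mathrm{Con}(\mathbf a)$, $\mathbf a\in\mathcal V$, and $(a,b,c,d),(a,b,c',d)\in R(\alpha,\beta)$. **Theorem 8.3.** Let $\mathcal V$ be a variety with a difference term $p$, let $q$ be an arbitrary Kiss term for $\mathcal V$, let $\mathbf a\in\mathcal V$, and let $\alpha,\beta\in\mathrm{Con}(\mathbf a)$ satisfy $[\alpha,\beta]=0$.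 Put $$R^-(\alpha,\beta)=\{(a,b,d)\in A^3 : (a,b,c,d)\in R(\alpha,\beta)\text{ for some }c\in A\}.$$ Then there is a well-defined function $q^-\colon R^-(\alpha,\beta)\to A$ with $q^-(a,b,d)=q(a,b,c,d)$ for all $(a,b,c,d)\in R(\alpha,\beta)$, and the following hold. 1. $\Delta^*(\alpha,\beta)=\left\{\begin{bmatrix}a&q^-(a,b,d)\\b&d\end{bmatrix} : (a,b,d)\in R^-(\alpha,\beta)\right\}.$ 2. If $\alpha\le\beta$, then $q^-(a,b,d)=p(a,b,d)$ for all $(a,b,d)\in R^-(\alpha,\beta)$, hence $$\Delta^*(\alpha,\beta)=\left\{\begin{bmatrix}a&p(a,b,d)\\b&d\end{bmatrix} : (a,b,d)\in R^-(\alpha,\beta)\right\}.$$ -/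

import Mathlib

open FirstOrder

universe u v w

/-- A congruence of an algebra `A`: an equivalence relation that is compatible with all basic
operations. (An algebra is a structure over a first-order language without relation symbols.) -/
structure Congruence (L : FirstOrder.Language.{u, v}) (A : Type w) [L.Structure A] extends Setoid A where
  compat : ∀ {n : ℕ} (f : L.Functions n) (x y : Fin n → A),
    (∀ i, r (x i) (y i)) → r (FirstOrder.Language.Structure.funMap f x) (FirstOrder.Language.Structure.funMap f y)

namespace Congruence

variable {L : FirstOrder.Language.{u, v}} {A : Type w} [L.Structure A]

/-- The inclusion order of congruences. -/
instance : LE (Congruence L A) := ⟨fun α β => ∀ a b : A, α.r a b → β.r a b⟩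

/-- The congruence `0`, i.e. equality. -/
instance : Bot (Congruence L A) :=
  ⟨{ toSetoid := ⟨fun a b => a = b, eq_equivalence⟩
     compat := fun f _ _ h => congrArg (FirstOrder.Language.Structure.funMap f) (funext h) }⟩

/-- The intersection of a family of congruences. -/
instance : InfSet (Congruence L A) :=
  ⟨fun S =>
    { toSetoid := ⟨fun a b => ∀ δ ∈ S, δ.r a b,
        ⟨fun a δ _ => δ.iseqv.refl a, fun h δ hδ => δ.iseqv.symm (h δ hδ),
          fun h k δ hδ => δ.iseqv.trans (h δ hδ) (k δ hδ)⟩⟩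
      compat := fun f x y h δ hδ => δ.compat f x y fun i => h i δ hδ }⟩

/-- `R(α,β)`: the 2×2 matrices over `A` with columns in `α` and rows in `β`. The 4-tuple
`(a,b,c,d)` corresponds to the matrix `!![a, c; b, d]`. -/
def R (α β : Congruence L A) : Set (Matrix (Fin 2) (Fin 2) A) :=
  {X | α.r (X 0 0) (X 1 0) ∧ α.r (X 0 1) (X 1 1) ∧ β.r (X 0 0) (X 0 1) ∧ β.r (X 1 0) (X 1 1)}

/-- `M(α,β)`: the subalgebra of the algebra of 2×2 matrices over `A` (with entrywise operations)
generated by the matrices `!![c, c; d, d]` with `(c,d) ∈ α` and `!![a, c; a, c]` with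
`(a,c) ∈ β`. -/
inductive M (α β : Congruence L A) : Set (Matrix (Fin 2) (Fin 2) A)
  | col (c d : A) : α.r c d → M α β !![c, c; d, d]
  | row (a c : A) : β.r a c → M α β !![a, c; a, c]
  | op {n : ℕ} (f : L.Functions n) (X : Fin n → Matrix (Fin 2) (Fin 2) A) :
      (∀ k, M α β (X k)) →
      M α β (Matrix.of fun i j => FirstOrder.Language.Structure.funMap f fun k => X k i j)

/-- The term condition `C(α,β;δ)`: if one row of a matrix in `M(α,β)` is in `δ`, so is the other.
(`M(α,β)` is closed under interchanging the rows.) -/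
def Centralizes (α β δ : Congruence L A) : Prop :=
  ∀ a b c d : A, !![a, c; b, d] ∈ M α β → δ.r b d → δ.r a c

/-- The commutator `[α,β]`: the least congruence `δ` with `C(α,β;δ)`. -/
def commutator (α β : Congruence L A) : Congruence L A :=
  sInf {δ | Centralizes α β δ}

/-- The infimum that defines the commutator is attained. -/
theorem centralizes_commutator (α β : Congruence L A) : Centralizes α β (commutator α β) :=
  fun a b c d hM h δ hδ => hδ a b c d hM (h δ hδ)

/-- `Δ*(α,β)`: the horizontal and vertical transitive closure of `M(α,β)`. -/
inductive DeltaStar (α β : Congruence L A) : Set (Matrix (Fin 2) (Fin 2) A)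
  | base (X : Matrix (Fin 2) (Fin 2) A) : X ∈ M α β → DeltaStar α β X
  | hglue (a a' a'' b b' b'' : A) : DeltaStar α β !![a, a'; b, b'] →
      DeltaStar α β !![a', a''; b', b''] → DeltaStar α β !![a, a''; b, b'']
  | vglue (a a' b b' c c' : A) : DeltaStar α β !![a, a'; b, b'] →
      DeltaStar α β !![b, b'; c, c'] → DeltaStar α β !![a, a'; c, c']

theorem M_subset_R (α β : Congruence L A) : M α β ⊆ R α β := by
  intro X hX
  induction hX with
  | col c d h => exact ⟨h, h, β.iseqv.refl _, β.iseqv.refl _⟩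
  | row a c h => exact ⟨α.iseqv.refl _, α.iseqv.refl _, h, h⟩
  | op f X _ ih =>
    exact ⟨α.compat f _ _ fun k => (ih k).1, α.compat f _ _ fun k => (ih k).2.1,
      β.compat f _ _ fun k => (ih k).2.2.1, β.compat f _ _ fun k => (ih k).2.2.2⟩

/-- `Δ*(α,β)` is the smallest subset of `R(α,β)` that contains `M(α,β)` and is closed under
horizontal and vertical gluing. -/
theorem isLeast_deltaStar (α β : Congruence L A) :
    IsLeast {S : Set (Matrix (Fin 2) (Fin 2) A) | S ⊆ R α β ∧ M α β ⊆ S ∧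
      (∀ a a' a'' b b' b'' : A, !![a, a'; b, b'] ∈ S → !![a', a''; b', b''] ∈ S →
        !![a, a''; b, b''] ∈ S) ∧
      (∀ a a' b b' c c' : A, !![a, a'; b, b'] ∈ S → !![b, b'; c, c'] ∈ S →
        !![a, a'; c, c'] ∈ S)} (DeltaStar α β) := by
  refine ⟨⟨?_, .base, .hglue, .vglue⟩, ?_⟩
  · intro X hX
    induction hX with
    | base X h => exact M_subset_R α β h
    | hglue a a' a'' b b' b'' _ _ h k =>
      exact ⟨h.1, k.2.1, β.iseqv.trans h.2.2.1 k.2.2.1, β.iseqv.trans h.2.2.2 k.2.2.2⟩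
    | vglue a a' b b' c c' _ _ h k =>
      exact ⟨α.iseqv.trans h.1 k.1, α.iseqv.trans h.2.1 k.2.1, h.2.2.1, k.2.2.2⟩
  · rintro S ⟨_, hM, hh, hv⟩ X hX
    induction hX with
    | base X h => exact hM h
    | hglue a a' a'' b b' b'' _ _ h k => exact hh _ _ _ _ _ _ h k
    | vglue a a' b b' c c' _ _ h k => exact hv _ _ _ _ _ _ h k

/-- `R⁻(α,β)`: the triples `(a,b,d)` that occur in a matrix `!![a, c; b, d]` in `R(α,β)`. -/
def RMinus (α β : Congruence L A) : Set (A × A × A) :=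
  {t | ∃ c : A, !![t.1, c; t.2.1, t.2.2] ∈ R α β}

/-- The function `q⁻ : R⁻(α,β) → A` with `q⁻(a,b,d) = q(a,b,c,d)`, where `c` is any element with
`!![a, c; b, d] ∈ R(α,β)`. (A choice of `c` is made here; that the value does not depend on the
choice when `[α,β] = 0` has to be proved.) -/
noncomputable def qMinus (q : L.Term (Fin 4)) (α β : Congruence L A) (t : RMinus α β) : A :=
  q.realize ![t.1.1, t.1.2.1, t.2.choose, t.1.2.2]

end Congruence

/-- A variety, given by a set of identities. -/
structure Variety (L : FirstOrder.Language.{u, v}) where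
  identities : Set (L.Term ℕ × L.Term ℕ)

/-- The algebra `A` belongs to the variety, i.e. satisfies all its identities. -/
def Variety.Contains {L : FirstOrder.Language.{u, v}} (V : Variety L) (A : Type w) [L.Structure A] : Prop :=
  ∀ e ∈ V.identities, ∀ x : ℕ → A, e.1.realize x = e.2.realize x

/-- `p` is a (ternary) difference term for `V`. The algebras range over a universe that is at
least as large as the one of the operation symbols, so that free algebras of `V` are included. -/
def Variety.IsDifferenceTerm {L : FirstOrder.Language.{u, v}} (V : Variety L) (p : L.Term (Fin 3)) : Prop :=
  ∀ (A : Type (max u w)) [L.Structure A], V.Contains A →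
    (∀ a b : A, p.realize ![a, a, b] = b) ∧
    (∀ (θ : Congruence L A) (a b : A), θ.r a b →
      (Congruence.commutator θ θ).r (p.realize ![a, b, b]) a)

/-- `q` is a Kiss term (a 4-ary difference term) for `V`. -/
def Variety.IsKissTerm {L : FirstOrder.Language.{u, v}} (V : Variety L) (q : L.Term (Fin 4)) : Prop :=
  ∀ (A : Type (max u w)) [L.Structure A], V.Contains A →
    (∀ a b : A, q.realize ![a, a, b, b] = b) ∧
    (∀ a b : A, q.realize ![a, b, a, b] = a) ∧
    (∀ (α β : Congruence L A) (a b c c' d : A),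
      !![a, c; b, d] ∈ Congruence.R α β → !![a, c'; b, d] ∈ Congruence.R α β →
      (Congruence.commutator α β).r (q.realize ![a, b, c, d]) (q.realize ![a, b, c', d]))

/-! Since `[α,β] = 0`, a matrix in `Δ*` with constant bottom row has constant top row. For `M` this
is the term condition. It survives gluing: the column version (constant left column forces constant
right column) passes to horizontal composites, the row version to vertical ones, and `p`, a Maltsev
operation on the blocks of `α ∧ β`, converts one version into the other (`deltaStar_central`).
Applying `q` to four matrices of `Δ*` then shows that the entry `c` of a matrix in `Δ*` is
`q(a,b,c,d)` (`kiss_eq_of_mem_deltaStar`), so `Δ*` lies in the graph of `q⁻`.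

Conversely, `Δ*` is a congruence of the algebra `α ≤ A × A`, which lies in the variety. It contains
the commutator of two congruences of `α` induced by `β` (`centralizes_deltaCongruence`), so the Kiss
property in `α` places the graph inside `Δ*` (`kiss_mem_deltaStar`). If `α ≤ β`, then `p(a,b,d)`
also completes `a, b, d` to a matrix in `Δ*`, and uniqueness of the completion gives `q⁻ = p`. -/

namespace Congruence

variable {L : FirstOrder.Language.{u, v}} {A : Type w} [L.Structure A]

/-- A set of squares `N a c b d` (the matrix with rows `a c` and `b d`) contained in `R(α,β)` that
is a subalgebra, contains the generators of `M(α,β)`, and is closed under interchanging the rows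
and interchanging the columns. -/
structure IsSquareAlgebra (α β : Congruence L A) (N : A → A → A → A → Prop) : Prop where
  left : ∀ {a c b d}, N a c b d → α.r a b
  right : ∀ {a c b d}, N a c b d → α.r c d
  top : ∀ {a c b d}, N a c b d → β.r a c
  bottom : ∀ {a c b d}, N a c b d → β.r b d
  col : ∀ {c d}, α.r c d → N c c d d
  row : ∀ {a c}, β.r a c → N a c a c
  op : ∀ {n : ℕ} (f : L.Functions n) (a c b d : Fin n → A), (∀ k, N (a k) (c k) (b k) (d k)) →
    N (Language.Structure.funMap f a) (Language.Structure.funMap f c)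
      (Language.Structure.funMap f b) (Language.Structure.funMap f d)
  swapRows : ∀ {a c b d}, N a c b d → N b d a c
  swapCols : ∀ {a c b d}, N a c b d → N c a d b

/-! ### Composites and unions of square algebras; row versus column centrality -/

namespace IsSquareAlgebra

variable {α β : Congruence L A} {N : A → A → A → A → Prop}

theorem const (hN : IsSquareAlgebra α β N) (a : A) : N a a a a := hN.col (α.iseqv.refl a)

theorem term (hN : IsSquareAlgebra α β N) {ι : Type*} (t : L.Term ι) (a c b d : ι → A)
    (h : ∀ k, N (a k) (c k) (b k) (d k)) :
    N (t.realize a) (t.realize c) (t.realize b) (t.realize d) := by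
  induction t with
  | var k => exact h k
  | func f ts ih => exact hN.op f _ _ _ _ ih

theorem hcomp (hN : IsSquareAlgebra α β N) :
    IsSquareAlgebra α β fun a c b d => ∃ e f, N a e b f ∧ N e c f d where
  left := fun ⟨_, _, h, _⟩ => hN.left h
  right := fun ⟨_, _, _, h⟩ => hN.right h
  top := fun ⟨_, _, h, k⟩ => β.iseqv.trans (hN.top h) (hN.top k)
  bottom := fun ⟨_, _, h, k⟩ => β.iseqv.trans (hN.bottom h) (hN.bottom k)
  col := fun h => ⟨_, _, hN.col h, hN.col h⟩
  row := fun h => ⟨_, _, hN.row h, hN.row (β.iseqv.refl _)⟩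
  op := fun f a c b d h => by
    choose e g h k using h
    exact ⟨_, _, hN.op f a e b g h, hN.op f e c g d k⟩
  swapRows := fun ⟨_, _, h, k⟩ => ⟨_, _, hN.swapRows h, hN.swapRows k⟩
  swapCols := fun ⟨_, _, h, k⟩ => ⟨_, _, hN.swapCols k, hN.swapCols h⟩

theorem vcomp (hN : IsSquareAlgebra α β N) :
    IsSquareAlgebra α β fun a c b d => ∃ e f, N a c e f ∧ N e f b d where
  left := fun ⟨_, _, h, k⟩ => α.iseqv.trans (hN.left h) (hN.left k)
  right := fun ⟨_, _, h, k⟩ => α.iseqv.trans (hN.right h) (hN.right k)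
  top := fun ⟨_, _, h, _⟩ => hN.top h
  bottom := fun ⟨_, _, _, h⟩ => hN.bottom h
  col := fun h => ⟨_, _, hN.col h, hN.col (α.iseqv.refl _)⟩
  row := fun h => ⟨_, _, hN.row h, hN.row h⟩
  op := fun f a c b d h => by
    choose e g h k using h
    exact ⟨_, _, hN.op f a c e g h, hN.op f e g b d k⟩
  swapRows := fun ⟨_, _, h, k⟩ => ⟨_, _, hN.swapRows k, hN.swapRows h⟩
  swapCols := fun ⟨_, _, h, k⟩ => ⟨_, _, hN.swapCols h, hN.swapCols k⟩

/-- Operations are finitary, so the finitely many arguments of one operation lie in a common stage.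
-/
theorem iSup {S : ℕ → A → A → A → A → Prop} (hS : ∀ n, IsSquareAlgebra α β (S n))
    (mono : Monotone S) : IsSquareAlgebra α β fun a c b d => ∃ n, S n a c b d where
  left := fun ⟨n, h⟩ => (hS n).left h
  right := fun ⟨n, h⟩ => (hS n).right h
  top := fun ⟨n, h⟩ => (hS n).top h
  bottom := fun ⟨n, h⟩ => (hS n).bottom h
  col := fun h => ⟨0, (hS 0).col h⟩
  row := fun h => ⟨0, (hS 0).row h⟩
  op := fun f a c b d h => by
    choose n h using h
    exact ⟨Finset.univ.sup n, (hS _).op f a c b d fun k =>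
      mono (Finset.le_sup (Finset.mem_univ k)) _ _ _ _ (h k)⟩
  swapRows := fun ⟨n, h⟩ => ⟨n, (hS n).swapRows h⟩
  swapCols := fun ⟨n, h⟩ => ⟨n, (hS n).swapCols h⟩

/-- If `p` is a Maltsev operation on the blocks of `α ∧ β`, then centrality for rows implies
centrality for columns. -/
theorem right_eq_of_left_eq (hN : IsSquareAlgebra α β N) (p : L.Term (Fin 3))
    (hp : ∀ a b : A, p.realize ![a, a, b] = b)
    (hp' : ∀ a b : A, α.r a b → β.r a b → p.realize ![a, b, b] = a)
    (cent : ∀ a c b, N a c b b → a = c) {a c d : A} (h : N a c a d) : c = d := by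
  -- The resulting square has rows `c c` and `c d`; its top row is constant.
  have key := hN.term p ![a, a, c] ![c, c, c] ![a, a, c] ![d, c, c] (by
    simp only [Fin.forall_fin_succ]
    exact ⟨h, hN.row (hN.top h), hN.const c, fun i => i.elim0⟩)
  rw [hp, hp, hp' d c (α.iseqv.symm (hN.right h))
    (β.iseqv.trans (β.iseqv.symm (hN.bottom h)) (hN.top h))] at key
  exact cent _ _ _ (hN.swapRows key)

/-- The transpose of the preceding argument: here `p` produces the square with rows `a a` and `a c`.
-/
theorem top_eq_of_bottom_eq (hN : IsSquareAlgebra α β N) (p : L.Term (Fin 3))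
    (hp : ∀ a b : A, p.realize ![a, a, b] = b)
    (hp' : ∀ a b : A, α.r a b → β.r a b → p.realize ![a, b, b] = a)
    (cent : ∀ a c d, N a c a d → c = d) {a c b : A} (h : N a c b b) : a = c := by
  have key := hN.term p ![b, b, a] ![b, b, a] ![a, a, a] ![c, a, a] (by
    simp only [Fin.forall_fin_succ]
    exact ⟨hN.swapRows h, hN.swapRows (hN.col (hN.left h)), hN.const a, fun i => i.elim0⟩)
  rw [hp, hp, hp' c a (α.iseqv.trans (hN.right h) (α.iseqv.symm (hN.left h)))
    (β.iseqv.symm (hN.top h))] at key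
  exact cent _ _ _ key

end IsSquareAlgebra

/-! ### `M` and `Δ*` as square algebras -/

theorem isSquareAlgebra_M (α β : Congruence L A) :
    IsSquareAlgebra α β fun a c b d => !![a, c; b, d] ∈ M α β where
  left h := (M_subset_R α β h).1
  right h := (M_subset_R α β h).2.1
  top h := (M_subset_R α β h).2.2.1
  bottom h := (M_subset_R α β h).2.2.2
  col h := M.col _ _ h
  row h := M.row _ _ h
  op f a c b d h := by
    have key := M.op f (fun k => !![a k, c k; b k, d k]) h
    rw [Matrix.eta_fin_two (Matrix.of _)] at key
    exact key
  swapRows := by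
    suffices H : ∀ X ∈ M α β, !![X 1 0, X 1 1; X 0 0, X 0 1] ∈ M α β from
      fun {_ _ _ _} h => H _ h
    intro X hX
    induction hX with
    | col c d h => exact M.col d c (α.iseqv.symm h)
    | row a c h => exact M.row a c h
    | op f X _ ih =>
      have key := M.op f _ ih
      rw [Matrix.eta_fin_two (Matrix.of _)] at key
      exact key
  swapCols := by
    suffices H : ∀ X ∈ M α β, !![X 0 1, X 0 0; X 1 1, X 1 0] ∈ M α β from
      fun {_ _ _ _} h => H _ h
    intro X hX
    induction hX with
    | col c d h => exact M.col c d h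
    | row a c h => exact M.row c a (β.iseqv.symm h)
    | op f X _ ih =>
      have key := M.op f _ ih
      rw [Matrix.eta_fin_two (Matrix.of _)] at key
      exact key

/-- The stages of the construction of `Δ*(α,β)` from `M(α,β)` by alternately gluing horizontally
and vertically. -/
def deltaStage (α β : Congruence L A) : ℕ → A → A → A → A → Prop
  | 0 => fun a c b d => !![a, c; b, d] ∈ M α β
  | n + 1 => fun a c b d => ∃ e f,
      (∃ g h, deltaStage α β n a g e h ∧ deltaStage α β n g c h f) ∧
      (∃ g h, deltaStage α β n e g b h ∧ deltaStage α β n g f h d)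

theorem isSquareAlgebra_deltaStage (α β : Congruence L A) (n : ℕ) :
    IsSquareAlgebra α β (deltaStage α β n) := by
  induction n with
  | zero => exact isSquareAlgebra_M α β
  | succ n ih => exact ih.hcomp.vcomp

theorem deltaStage_hglue {α β : Congruence L A} {n : ℕ} {a a' a'' b b' b'' : A}
    (h : deltaStage α β n a a' b b') (k : deltaStage α β n a' a'' b' b'') :
    deltaStage α β (n + 1) a a'' b b'' := by
  have hn := isSquareAlgebra_deltaStage α β n
  have hb := β.iseqv.trans (hn.bottom h) (hn.bottom k)
  -- A stage glues in both directions, so the unwanted vertical gluing is padded with a degenerate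
  -- square.
  exact ⟨b, b'', ⟨_, _, h, k⟩, ⟨_, _, hn.row hb, hn.row (β.iseqv.refl _)⟩⟩

theorem deltaStage_vglue {α β : Congruence L A} {n : ℕ} {a a' b b' c c' : A}
    (h : deltaStage α β n a a' b b') (k : deltaStage α β n b b' c c') :
    deltaStage α β (n + 1) a a' c c' := by
  have hn := isSquareAlgebra_deltaStage α β n
  exact ⟨b, b', ⟨_, _, h, hn.col (hn.right h)⟩, ⟨_, _, k, hn.col (hn.right k)⟩⟩

theorem deltaStage_mono (α β : Congruence L A) : Monotone (deltaStage α β) :=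
  monotone_nat_of_le_succ fun n _ _ _ _ h => deltaStage_hglue h
    ((isSquareAlgebra_deltaStage α β n).col ((isSquareAlgebra_deltaStage α β n).right h))

theorem mem_deltaStar_iff {α β : Congruence L A} {a c b d : A} :
    !![a, c; b, d] ∈ DeltaStar α β ↔ ∃ n, deltaStage α β n a c b d := by
  constructor
  · suffices H : ∀ X ∈ DeltaStar α β, ∃ n, deltaStage α β n (X 0 0) (X 0 1) (X 1 0) (X 1 1) from
      fun h => H _ h
    intro X hX
    induction hX with
    | base X h => exact ⟨0, by rw [Matrix.eta_fin_two X] at h; exact h⟩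
    | hglue a a' a'' b b' b'' _ _ h k =>
      obtain ⟨⟨m, h⟩, ⟨n, k⟩⟩ := And.intro h k
      exact ⟨_, deltaStage_hglue (deltaStage_mono α β (le_max_left m n) _ _ _ _ h)
        (deltaStage_mono α β (le_max_right m n) _ _ _ _ k)⟩
    | vglue a a' b b' c c' _ _ h k =>
      obtain ⟨⟨m, h⟩, ⟨n, k⟩⟩ := And.intro h k
      exact ⟨_, deltaStage_vglue (deltaStage_mono α β (le_max_left m n) _ _ _ _ h)
        (deltaStage_mono α β (le_max_right m n) _ _ _ _ k)⟩
  · rintro ⟨n, h⟩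
    induction n generalizing a c b d with
    | zero => exact .base _ h
    | succ n ih =>
      obtain ⟨e, f, ⟨g, g', h₁, h₂⟩, ⟨k, k', h₃, h₄⟩⟩ := h
      exact .vglue _ _ _ _ _ _ (.hglue _ _ _ _ _ _ (ih h₁) (ih h₂))
        (.hglue _ _ _ _ _ _ (ih h₃) (ih h₄))

/-- Members of `Δ*` may be glued in different patterns, which obscures closure under operations;
within a stage the pattern is uniform. -/
theorem isSquareAlgebra_deltaStar (α β : Congruence L A) :
    IsSquareAlgebra α β fun a c b d => !![a, c; b, d] ∈ DeltaStar α β := by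
  simp only [mem_deltaStar_iff]
  exact .iSup (isSquareAlgebra_deltaStage α β) (deltaStage_mono α β)

/-! ### Centrality of `Δ*` and uniqueness of the upper right entry -/

/-- The term condition `C(α,β;0)` passes from `M(α,β)` to `Δ*(α,β)`. -/
theorem deltaStar_central {α β : Congruence L A} (hαβ : Centralizes α β ⊥) (p : L.Term (Fin 3))
    (hp : ∀ a b : A, p.realize ![a, a, b] = b)
    (hp' : ∀ a b : A, α.r a b → β.r a b → p.realize ![a, b, b] = a)
    {a c b : A} (h : !![a, c; b, b] ∈ DeltaStar α β) : a = c := by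
  obtain ⟨n, h⟩ := mem_deltaStar_iff.1 h
  induction n generalizing a c b with
  | zero => exact hαβ a b c b h rfl
  | succ n ih =>
    have hn := isSquareAlgebra_deltaStage α β n
    -- Convert row centrality of stage `n` to columns, pass it through the horizontal composite, and
    -- convert back; the vertical composite then preserves it directly.
    have hcomp_central : ∀ a c b, (∃ e f, deltaStage α β n a e b f ∧ deltaStage α β n e c f b) →
        a = c := by
      intro a c b h
      refine hn.hcomp.top_eq_of_bottom_eq p hp hp' ?_ h
      rintro a c d ⟨e, f, h, k⟩
      have ih' : ∀ a c b, deltaStage α β n a c b b → a = c := fun a c b h =>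
        ih (mem_deltaStar_iff.2 ⟨n, h⟩) h
      obtain rfl := hn.right_eq_of_left_eq p hp hp' ih' h
      exact hn.right_eq_of_left_eq p hp hp' ih' k
    obtain ⟨e, f, h, k⟩ := h
    obtain rfl := hcomp_central _ _ _ k
    exact hcomp_central _ _ _ h

/-- Four squares are chosen so that `q` yields the rows `c q(a,b,c,d)` and `c c`; centrality
finishes. -/
theorem kiss_eq_of_mem_deltaStar {α β : Congruence L A} (hαβ : Centralizes α β ⊥)
    (p : L.Term (Fin 3)) (hp : ∀ a b : A, p.realize ![a, a, b] = b)
    (hp' : ∀ a b : A, α.r a b → β.r a b → p.realize ![a, b, b] = a)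
    (q : L.Term (Fin 4)) (hq : ∀ a b : A, q.realize ![a, a, b, b] = b)
    (hq' : ∀ a b : A, q.realize ![a, b, a, b] = a)
    {a c b d : A} (h : !![a, c; b, d] ∈ DeltaStar α β) : q.realize ![a, b, c, d] = c := by
  have hD := isSquareAlgebra_deltaStar α β
  have key := hD.term q ![c, d, c, d] ![a, b, c, d] ![c, c, c, c] ![a, a, c, c] (by
    simp only [Fin.forall_fin_succ]
    exact ⟨hD.swapCols (hD.row (hD.top h)), hD.swapRows (hD.swapCols h), hD.const c,
      hD.swapRows (hD.col (hD.right h)), fun i => i.elim0⟩)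
  rw [hq', hq', hq] at key
  exact (deltaStar_central hαβ p hp hp' key).symm

/-! ### The algebra `α` and the Kiss property inside it -/

/-- The subalgebra `α` of `A × A`. -/
def Pairs (α : Congruence L A) : Type w := {x : A × A // α.r x.1 x.2}

instance [L.IsAlgebraic] (α : Congruence L A) : L.Structure (Pairs α) where
  funMap f x := ⟨(Language.Structure.funMap f fun i => (x i).1.1,
    Language.Structure.funMap f fun i => (x i).1.2), α.compat f _ _ fun i => (x i).2⟩
  RelMap r _ := isEmptyElim r

theorem realize_pairs [L.IsAlgebraic] (α : Congruence L A) {ι : Type*} (t : L.Term ι)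
    (x : ι → Pairs α) :
    (t.realize x).1 = (t.realize fun i => (x i).1.1, t.realize fun i => (x i).1.2) := by
  induction t with
  | var k => rfl
  | func f ts ih =>
    refine Prod.ext ?_ ?_
    · exact congrArg (Language.Structure.funMap f) (funext fun i => congrArg Prod.fst (ih i))
    · exact congrArg (Language.Structure.funMap f) (funext fun i => congrArg Prod.snd (ih i))

theorem contains_pairs [L.IsAlgebraic] {V : Variety L} (hA : V.Contains A) (α : Congruence L A) :
    V.Contains (Pairs α) := fun e he x => Subtype.ext <| by
  rw [realize_pairs, realize_pairs, hA e he, hA e he]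

/-- `Δ*(α,β)` as a congruence of the algebra `α`. -/
def deltaCongruence [L.IsAlgebraic] (α β : Congruence L A) : Congruence L (Pairs α) where
  r x y := !![x.1.1, y.1.1; x.1.2, y.1.2] ∈ DeltaStar α β
  iseqv := ⟨fun x => (isSquareAlgebra_deltaStar α β).col x.2,
    (isSquareAlgebra_deltaStar α β).swapCols, .hglue _ _ _ _ _ _⟩
  compat f _ _ h := (isSquareAlgebra_deltaStar α β).op f _ _ _ _ h

/-- The congruence of the algebra `α` given by `β` in both coordinates. -/
def bothCongruence [L.IsAlgebraic] (α β : Congruence L A) : Congruence L (Pairs α) where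
  r x y := β.r x.1.1 y.1.1 ∧ β.r x.1.2 y.1.2
  iseqv := ⟨fun _ => ⟨β.iseqv.refl _, β.iseqv.refl _⟩,
    fun h => ⟨β.iseqv.symm h.1, β.iseqv.symm h.2⟩,
    fun h k => ⟨β.iseqv.trans h.1 k.1, β.iseqv.trans h.2 k.2⟩⟩
  compat f _ _ h := ⟨β.compat f _ _ fun i => (h i).1, β.compat f _ _ fun i => (h i).2⟩

/-- The congruence of the algebra `α` given by `β` in the second coordinate. -/
def sndCongruence [L.IsAlgebraic] (α β : Congruence L A) : Congruence L (Pairs α) where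
  r x y := β.r x.1.2 y.1.2
  iseqv := ⟨fun _ => β.iseqv.refl _, β.iseqv.symm, β.iseqv.trans⟩
  compat f _ _ h := β.compat f _ _ h

/-- The four pairs are vertical edges of a cube. Each edge gets an intermediate point so that the
upper faces in the row direction and the lower faces in the column direction lie in `Δ*`. Generators
take an endpoint of each edge, and the condition is preserved by operations. -/
theorem exists_of_mem_M_pairs [L.IsAlgebraic] {α β : Congruence L A}
    {X : Matrix (Fin 2) (Fin 2) (Pairs α)}
    (hX : X ∈ M (sndCongruence α β) (bothCongruence α β)) :
    ∃ a c b d : A,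
      !![(X 0 0).1.1, (X 0 1).1.1; a, c] ∈ DeltaStar α β ∧
      !![(X 1 0).1.1, (X 1 1).1.1; b, d] ∈ DeltaStar α β ∧
      !![a, b; (X 0 0).1.2, (X 1 0).1.2] ∈ DeltaStar α β ∧
      !![c, d; (X 0 1).1.2, (X 1 1).1.2] ∈ DeltaStar α β := by
  have hD := isSquareAlgebra_deltaStar α β
  induction hX with
  | col c d h => exact ⟨_, _, _, _, hD.col c.2, hD.col d.2, hD.row h, hD.row h⟩
  | row a c h => exact ⟨_, _, _, _, hD.row h.1, hD.row h.1, hD.col a.2, hD.col c.2⟩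
  | op f X _ ih =>
    choose a c b d h₁ h₂ h₃ h₄ using ih
    exact ⟨_, _, _, _, hD.op f _ _ _ _ h₁, hD.op f _ _ _ _ h₂, hD.op f _ _ _ _ h₃,
      hD.op f _ _ _ _ h₄⟩

theorem centralizes_deltaCongruence [L.IsAlgebraic] (α β : Congruence L A) :
    Centralizes (sndCongruence α β) (bothCongruence α β) (deltaCongruence α β) := by
  intro a b c d hM hbd
  have hD := isSquareAlgebra_deltaStar α β
  obtain ⟨a', c', b', d', h₁, h₂, h₃, h₄⟩ := exists_of_mem_M_pairs hM
  -- The lower part of the wanted face is reached by going around the other three faces of the cube.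
  exact .vglue _ _ _ _ _ _ h₁ (.hglue _ _ _ _ _ _ (.hglue _ _ _ _ _ _ h₃
    (.vglue _ _ _ _ _ _ (hD.swapRows h₂) hbd)) (hD.swapCols h₄))

theorem kiss_mem_deltaStar [L.IsAlgebraic] {α β : Congruence L A} (q : L.Term (Fin 4))
    (hq : ∀ a b : A, q.realize ![a, a, b, b] = b)
    (hq' : ∀ a b : A, q.realize ![a, b, a, b] = a)
    (hq'' : ∀ (γ δ : Congruence L (Pairs α)) (a b c c' d : Pairs α),
      !![a, c; b, d] ∈ R γ δ → !![a, c'; b, d] ∈ R γ δ →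
      (commutator γ δ).r (q.realize ![a, b, c, d]) (q.realize ![a, b, c', d]))
    {a b c d : A} (h : !![a, c; b, d] ∈ R α β) :
    !![a, q.realize ![a, b, c, d]; b, d] ∈ DeltaStar α β := by
  have hD := isSquareAlgebra_deltaStar α β
  obtain ⟨hab, hcd, hac, hbd⟩ : α.r a b ∧ α.r c d ∧ β.r a c ∧ β.r b d := h
  let x : Pairs α := ⟨(a, b), hab⟩
  let y : Pairs α := ⟨(b, b), α.iseqv.refl b⟩
  let z : Pairs α := ⟨(c, d), hcd⟩
  let w : Pairs α := ⟨(d, d), α.iseqv.refl d⟩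
  -- The third argument changes from `(a,b)` to `(c,d)`; the commutator lies below `deltaCongruence
  -- α β`, so the two values of `q` are related by `Δ*`.
  have key := hq'' (sndCongruence α β) (bothCongruence α β) x y x z w
    ⟨β.iseqv.refl b, hbd, ⟨β.iseqv.refl a, β.iseqv.refl b⟩, ⟨hbd, hbd⟩⟩
    ⟨β.iseqv.refl b, β.iseqv.refl d, ⟨hac, hbd⟩, ⟨hbd, hbd⟩⟩
    (deltaCongruence α β) (centralizes_deltaCongruence α β)
  have e : ∀ x₁ x₂ x₃ x₄ : Pairs α, (q.realize ![x₁, x₂, x₃, x₄]).1 =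
      (q.realize ![x₁.1.1, x₂.1.1, x₃.1.1, x₄.1.1],
        q.realize ![x₁.1.2, x₂.1.2, x₃.1.2, x₄.1.2]) := by
    intro x₁ x₂ x₃ x₄
    rw [realize_pairs]
    congr 2 <;> · funext i; fin_cases i <;> rfl
  have h₁ : !![q.realize ![a, b, a, d], q.realize ![a, b, c, d];
      q.realize ![b, b, b, d], q.realize ![b, b, d, d] ] ∈ DeltaStar α β := by
    have key' : !![(q.realize ![x, y, x, w]).1.1, (q.realize ![x, y, z, w]).1.1;
      (q.realize ![x, y, x, w]).1.2, (q.realize ![x, y, z, w]).1.2] ∈ DeltaStar α β := key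
    rwa [e, e] at key'
  -- This square has left column `a, b` and its right column is the left column of `h₁`.
  have h₂ := hD.term q ![a, b, a, b] ![a, b, a, d] ![b, b, b, b] ![b, b, b, d] (by
    simp only [Fin.forall_fin_succ]
    exact ⟨hD.col hab, hD.const b, hD.col hab, hD.row hbd, fun i => i.elim0⟩)
  have h₃ := DeltaStar.hglue _ _ _ _ _ _ h₂ h₁
  rwa [hq', hq', hq] at h₃

/-! ### The difference term -/

theorem difference_mem_deltaStar {α β : Congruence L A} (p : L.Term (Fin 3))
    (hp : ∀ a b : A, p.realize ![a, a, b] = b) {a b d : A} (hab : α.r a b) (hbd : β.r b d)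
    (hp' : p.realize ![a, b, b] = a) : !![a, p.realize ![a, b, d]; b, d] ∈ DeltaStar α β := by
  have hD := isSquareAlgebra_deltaStar α β
  have key := hD.term p ![a, b, b] ![a, b, d] ![b, b, b] ![b, b, d] (by
    simp only [Fin.forall_fin_succ]
    exact ⟨hD.col hab, hD.const b, hD.row hbd, fun i => i.elim0⟩)
  rwa [hp', hp, hp] at key

theorem M_mono {α β α' β' : Congruence L A} (hα : α' ≤ α) (hβ : β' ≤ β) : M α' β' ⊆ M α β := by
  intro X hX
  induction hX with
  | col c d h => exact M.col c d (hα _ _ h)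
  | row a c h => exact M.row a c (hβ _ _ h)
  | op f X _ ih => exact M.op f X ih

/-- For `θ = α ∧ β`, `M(θ,θ) ⊆ M(α,β)`, so equality satisfies the term condition for `θ, θ` and
`[θ,θ] = 0`. -/
theorem difference_right_eq {α β : Congruence L A} (hαβ : Centralizes α β ⊥) (p : L.Term (Fin 3))
    (hp : ∀ (θ : Congruence L A) (a b : A), θ.r a b →
      (commutator θ θ).r (p.realize ![a, b, b]) a)
    (a b : A) (h : α.r a b) (k : β.r a b) : p.realize ![a, b, b] = a := by
  have hα : sInf {α, β} ≤ α := fun _ _ h => h α (Or.inl rfl)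
  have hβ : sInf {α, β} ≤ β := fun _ _ h => h β (Or.inr rfl)
  refine hp (sInf {α, β}) a b ?_ ⊥ fun a b c d hM => hαβ a b c d (M_mono hα hβ hM)
  rintro δ (rfl | rfl)
  exacts [h, k]

end Congruence

theorem theorem8p3 {L : FirstOrder.Language.{u, v}} [L.IsAlgebraic] (V : Variety L)
    (p : L.Term (Fin 3)) (hp : Variety.IsDifferenceTerm.{u, v, w} V p)
    (q : L.Term (Fin 4)) (hq : Variety.IsKissTerm.{u, v, w} V q)
    (A : Type (max u w)) [L.Structure A] (hA : V.Contains A)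
    (α β : Congruence L A) (hαβ : Congruence.commutator α β = ⊥) :
    -- `q⁻` is well defined: it does not depend on the choice of the third argument
    (∀ (a b c d : A) (h : !![a, c; b, d] ∈ Congruence.R α β),
      Congruence.qMinus q α β ⟨(a, b, d), c, h⟩ = q.realize ![a, b, c, d]) ∧
    Congruence.DeltaStar α β =
      {X | ∃ (a b d : A) (h : (a, b, d) ∈ Congruence.RMinus α β),
        X = !![a, Congruence.qMinus q α β ⟨(a, b, d), h⟩; b, d]} ∧
    (α ≤ β →
      (∀ (a b d : A) (h : (a, b, d) ∈ Congruence.RMinus α β),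
        Congruence.qMinus q α β ⟨(a, b, d), h⟩ = p.realize ![a, b, d]) ∧
      Congruence.DeltaStar α β =
        {X | ∃ a b d : A, (a, b, d) ∈ Congruence.RMinus α β ∧
          X = !![a, p.realize ![a, b, d]; b, d]}) := by

  have hC : Congruence.Centralizes α β ⊥ := hαβ ▸ Congruence.centralizes_commutator α β
  obtain ⟨hp₁, hp₂⟩ := hp A hA
  have hp₃ := Congruence.difference_right_eq hC p hp₂
  obtain ⟨hq₁, hq₂, hq₃⟩ := hq A hA
  have indep : ∀ (a b c c' d : A), !![a, c; b, d] ∈ Congruence.R α β →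
      !![a, c'; b, d] ∈ Congruence.R α β →
      q.realize ![a, b, c, d] = q.realize ![a, b, c', d] := by
    intro a b c c' d h k
    have := hq₃ α β a b c c' d h k
    rwa [hαβ] at this
  have wd : ∀ (a b c d : A) (h : !![a, c; b, d] ∈ Congruence.R α β),
      Congruence.qMinus q α β ⟨(a, b, d), c, h⟩ = q.realize ![a, b, c, d] := fun a b c d h =>
    indep a b _ c d (Exists.choose_spec (⟨c, h⟩ : (a, b, d) ∈ Congruence.RMinus α β)) h
  have graph : ∀ (a b c d : A) (h : (a, b, d) ∈ Congruence.RMinus α β),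
      !![a, c; b, d] ∈ Congruence.DeltaStar α β →
      Congruence.qMinus q α β ⟨(a, b, d), h⟩ = c := fun a b c d _ hc =>
    (wd a b c d ((Congruence.isLeast_deltaStar α β).1.1 hc)).trans
      (Congruence.kiss_eq_of_mem_deltaStar hC p hp₁ hp₃ q hq₁ hq₂ hc)
  have eq₁ : Congruence.DeltaStar α β =
      {X | ∃ (a b d : A) (h : (a, b, d) ∈ Congruence.RMinus α β),
        X = !![a, Congruence.qMinus q α β ⟨(a, b, d), h⟩; b, d]} := by
    refine Set.Subset.antisymm (fun X hX => ?_) ?_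
    · rw [Matrix.eta_fin_two X] at hX ⊢
      have hR : (X 0 0, X 1 0, X 1 1) ∈ Congruence.RMinus α β :=
        ⟨_, (Congruence.isLeast_deltaStar α β).1.1 hX⟩
      exact ⟨_, _, _, hR, by rw [graph _ _ _ _ hR hX]⟩
    · rintro X ⟨a, b, d, ⟨c, h⟩, rfl⟩
      rw [wd a b c d h]
      exact Congruence.kiss_mem_deltaStar q hq₁ hq₂
        (hq (Congruence.Pairs α) (Congruence.contains_pairs hA α)).2.2 h
  refine ⟨wd, eq₁, fun hle => ?_⟩
  have eq₂ : ∀ (a b d : A) (h : (a, b, d) ∈ Congruence.RMinus α β),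
      Congruence.qMinus q α β ⟨(a, b, d), h⟩ = p.realize ![a, b, d] := by
    intro a b d h
    obtain ⟨c, hab, _, _, hbd⟩ := id h
    exact graph a b _ d h (Congruence.difference_mem_deltaStar p hp₁ hab hbd
      (hp₃ a b hab (hle _ _ hab)))
  refine ⟨eq₂, eq₁.trans (Set.ext fun X => ?_)⟩
  constructor
  · rintro ⟨a, b, d, h, rfl⟩
    exact ⟨a, b, d, h, by rw [eq₂]⟩
  · rintro ⟨a, b, d, h, rfl⟩
    exact ⟨a, b, d, h, by rw [eq₂]⟩
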